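/- Let $\mathbb{F}_q$ be a finite field of characteristic three and let $A, B \in \mathbb{F}_q[x]$ be such that the curve $T^3 - AT + B = 0$ is a standard model of a cubic function field, that is: $T^3 - AT + B$ is irreducible over $\mathbb{F}_q(x)$; $A \neq 0$; there are no polynomials $Q, i \in \mathbb{F}_q[x]$ with $Q$ non-constant, $Q^2 \mid A$ and $Q^3 \mid i^3 - iA + B$; and either ($3 \nmid \deg B$ and $2\deg B > 3 \deg A$) or $2 \deg B \leq 3 \deg A$, where $\deg 0 = 0$. Let $\mathcal{F} = \mathbb{F}_q(x)(y)$ with $y^3 - Ay + B = 0$, let $\mathcal{O}_\mathcal{F}$ be the integral closure of $\mathbb{F}_q[x]$ in $\mathcal{F}$, and let $\Delta \in \mathbb{F}_q[x]$ be the discriminant of $\mathcal{F}$, that is, the discriminant of a basis of $\mathcal{O}_\mathcal{F}$ over $\mathbb{F}_q[x]$. Let $P \in \mathbb{F}_q[x]$ be irreducible, let $v_P$ be the $P$-adic valuation, let $q_1 = q^{\deg P}$, and let $a, b$ be the residue classes of $A, B$ in the field $\mathbb{F}_q[x]/(P)$. Then the principal ideal $(P)$ of $\mathcal{O}_\mathcal{F}$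 decomposes as follows, where different letters denote different prime ideals of $\mathcal{O}_\mathcal{F}$: 1. If $v_P(\Delta) > 2$, then $(P) = \mathfrak{p}^3$. 2. If $v_P(\Delta) = 1$, then $(P) = \mathfrak{q}\mathfrak{p}^2$. 3. Otherwise $P \nmid A$; the polynomial $d = \gcd(T^{q_1} - T,\ T^3 - aT + b)$, computed in $(\mathbb{F}_q[x]/(P))[T]$, has degree $0$, $1$ or $3$; and (a) if $\deg d = 0$, then $(P) = \mathfrak{p}$; (b) if $\deg d = 1$, then $(P) = \mathfrak{p}\mathfrak{q}$; (c) if $\deg d = 3$, then $(P) = \mathfrak{p}\mathfrak{q}\mathfrak{r}$. -/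

import Mathlib

open Polynomial

namespace CubicCharThree

/-- The polynomial `T ^ 3 - a * T + b` in the variable `T`, over a commutative ring `R`. -/
noncomputable def cubic {R : Type*} [CommRing R] (a b : R) : R[X] :=
  X ^ 3 - C a * X + C b

/-- The curve `T ^ 3 - A * T + B = 0` is a standard model of a cubic function field in
characteristic three: `T ^ 3 - A * T + B` is irreducible and is not the purely inseparable
`T ^ 3 + B`, there is no non-constant `Q` for which `(y + i) / Q` is integral in the sense that
`Q ^ 2` divides `A` and `Q ^ 3` divides `i ^ 3 - i * A + B` for some `i`, and one of the two
conditions on the degrees of `A` and `B` holds. -/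
structure IsStandardModel {k : Type*} [Field k] (A B : k[X]) : Prop where
  irreducible : Irreducible (cubic A B)
  ne_zero : A ≠ 0
  reduced : ∀ Q i : k[X], Q ^ 2 ∣ A → Q ^ 3 ∣ i ^ 3 - i * A + B → Q.natDegree = 0
  degree_cond : (¬ 3 ∣ B.natDegree ∧ 3 * A.natDegree < 2 * B.natDegree) ∨
    2 * B.natDegree ≤ 3 * A.natDegree

/-- For an irreducible polynomial `P` over a finite field `k` with `q` elements,
`d = gcd (T ^ q₁ - T, T ^ 3 - a * T + b)`, computed over the residue field `k[x] / (P)`,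
where `q₁ = q ^ deg P` and `a`, `b` are the residue classes of `A` and `B` modulo `P`. -/
noncomputable def splittingGcd {k : Type*} [Field k] [Fintype k] (A B P : k[X])
    [Fact (Irreducible P)] : (AdjoinRoot P)[X] :=
  EuclideanDomain.gcd (X ^ (Fintype.card k ^ P.natDegree) - X)
    (cubic (AdjoinRoot.mk P A) (AdjoinRoot.mk P B))

end CubicCharThree

set_option linter.unusedSectionVars false

/-! In characteristic three the cubic has derivative `-A`, so a root `z` gives disc(1, z, z²) = A³,
and this equals Δ times the square of an index. Hence only primes dividing `A` can divide Δ.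

If `P ∣ A`, the residue field is perfect, so a translation of `z` makes `P` divide the constant
term; `A` and the discriminant do not change. Reducedness then leaves two kinds of Newton polygon. A
single slope 1/3 or 2/3 forces a ramification index divisible by 3; all traces are then divisible by
`P`, so P³ ∣ Δ (`span_eq_pow_three`). A segment of slope 1/2 forces a prime with e = 2; adjoining
z²/P removes P² from A³, which leaves valuation 1 (`span_eq_mul_sq`). Thus the valuation of Δ
separates the cases.

If `P ∤ A`, the powers of `z` form a basis locally at `P`, and the factorization of the cubic modulo
`P` governs that of (P). The map T ↦ T³ - aT is additive, so the roots form a coset of its kernel or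
the empty set, and there are 0, 1 or 3 of them; the gcd counts them. In every case enough primes are
exhibited to exhaust the identity ∑ e f = 3 (`span_eq_prod`). -/

namespace CubicCharThree

/-! ### Orders of vanishing at primes of a Dedekind domain -/

section Order

variable {S : Type*} [CommRing S] [IsDedekindDomain S]

/-- The order of vanishing of `x` at the ideal `𝔭`. -/
noncomputable def ord (𝔭 : Ideal S) (x : S) : ℕ∞ := emultiplicity 𝔭 (Ideal.span {x})

theorem natCast_le_ord_iff {𝔭 : Ideal S} {x : S} {n : ℕ} : (n : ℕ∞) ≤ ord 𝔭 x ↔ x ∈ 𝔭 ^ n := by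
  rw [ord, ← pow_dvd_iff_le_emultiplicity, Ideal.dvd_span_singleton]

theorem ord_pos_iff {𝔭 : Ideal S} {x : S} : 1 ≤ ord 𝔭 x ↔ x ∈ 𝔭 := by
  simpa using natCast_le_ord_iff (𝔭 := 𝔭) (x := x) (n := 1)

theorem ord_eq_zero_iff {𝔭 : Ideal S} {x : S} : ord 𝔭 x = 0 ↔ x ∉ 𝔭 := by
  rw [← ord_pos_iff, Order.one_le_iff_ne_zero, not_not]

theorem ord_mul {𝔭 : Ideal S} (h : Prime 𝔭) (x y : S) : ord 𝔭 (x * y) = ord 𝔭 x + ord 𝔭 y := by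
  rw [ord, ← Ideal.span_singleton_mul_span_singleton, emultiplicity_mul h, ord, ord]

theorem ord_pow {𝔭 : Ideal S} (h : Prime 𝔭) (x : S) (n : ℕ) : ord 𝔭 (x ^ n) = n * ord 𝔭 x := by
  rw [ord, ← Ideal.span_singleton_pow, emultiplicity_pow h, ord]

theorem ord_neg (𝔭 : Ideal S) (x : S) : ord 𝔭 (-x) = ord 𝔭 x := by
  rw [ord, Ideal.span_singleton_neg, ord]

theorem ord_add_of_lt {𝔭 : Ideal S} {x y : S} (h : ord 𝔭 x < ord 𝔭 y) :
    ord 𝔭 (x + y) = ord 𝔭 x := by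
  obtain ⟨n, hn⟩ := ENat.ne_top_iff_exists.mp h.ne_top
  have hy : y ∈ 𝔭 ^ (n + 1) := by
    rw [← natCast_le_ord_iff]
    push_cast
    rw [hn]
    exact Order.add_one_le_of_lt h
  have hx : x ∈ 𝔭 ^ n := natCast_le_ord_iff.mp hn.le
  have hx' : x ∉ 𝔭 ^ (n + 1) := by
    rw [← natCast_le_ord_iff, ← hn]
    exact_mod_cast (Nat.lt_succ_self n).not_ge
  rw [← hn]
  refine le_antisymm ?_ (natCast_le_ord_iff.mpr (add_mem hx (Ideal.pow_le_pow_right (by lia) hy)))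
  by_contra! hlt
  have h1 : ((n + 1 : ℕ) : ℕ∞) ≤ ord 𝔭 (x + y) := by
    push_cast
    exact Order.add_one_le_of_lt hlt
  exact hx' ((Ideal.add_mem_iff_left _ hy).mp (natCast_le_ord_iff.mp h1))

theorem ord_ne_top {𝔭 : Ideal S} (h : Prime 𝔭) {x : S} (hx : x ≠ 0) : ord 𝔭 x ≠ ⊤ := by
  rw [ord, ← finiteMultiplicity_iff_emultiplicity_ne_top]
  exact FiniteMultiplicity.of_prime_left h (by simpa using hx)

theorem dvd_of_ord_le {x y : S} (hx : x ≠ 0)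
    (h : ∀ 𝔭 : Ideal S, Prime 𝔭 → x ∈ 𝔭 → ord 𝔭 x ≤ ord 𝔭 y) : x ∣ y := by
  rw [← Ideal.mem_span_singleton, ← Ideal.dvd_span_singleton]
  refine (UniqueFactorizationMonoid.dvd_iff_emultiplicity_le (by simpa using hx)).mpr fun 𝔭 h𝔭 => ?_
  by_cases hm : x ∈ 𝔭
  · exact h 𝔭 h𝔭 hm
  · exact (ord_eq_zero_iff.mpr hm).le.trans zero_le

/-- With no prime containing both, `x` and `y` generate the unit ideal. This is how primes
containing a given factor are found. -/
theorem dvd_right_of_dvd_mul {x y z : S} (hd : x ∣ y * z)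
    (h : ∀ 𝔭 : Ideal S, 𝔭.IsPrime → x ∈ 𝔭 → y ∉ 𝔭) : x ∣ z := by
  have hc : IsCoprime x y := by
    rw [← Ideal.isCoprime_span_singleton_iff, Ideal.isCoprime_iff_sup_eq]
    by_contra hne
    obtain ⟨m, hm, hle⟩ := Ideal.exists_le_maximal _ hne
    rw [sup_le_iff, Ideal.span_singleton_le_iff_mem, Ideal.span_singleton_le_iff_mem] at hle
    exact h m hm.isPrime hle.1 hle.2
  exact hc.dvd_of_dvd_mul_left hd

end Order

/-! ### Decomposition of a prime in an extension of rank three -/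

section Decomposition

variable {R S : Type*} [CommRing R] [IsDomain R] [IsPrincipalIdealRing R]
  [CommRing S] [IsDedekindDomain S] [Algebra R S] (w : Module.Basis (Fin 3) R S)
  {P : R} (hP : Prime P)

include hP in
theorem isMaximal_span : (Ideal.span {P}).IsMaximal :=
  PrincipalIdealRing.isMaximal_of_irreducible hP.irreducible

include w in
theorem algebraMap_injective : Function.Injective (algebraMap R S) := by
  have := Module.Free.of_basis w
  have := w.index_nonempty
  exact FaithfulSMul.algebraMap_injective R S

include w hP in
theorem algebraMap_prime_ne_zero : algebraMap R S P ≠ 0 :=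
  (map_ne_zero_iff _ (algebraMap_injective w)).mpr hP.ne_zero

include hP in
theorem liesOver_span {𝔭 : Ideal S} (h𝔭 : 𝔭.IsPrime) (hm : algebraMap R S P ∈ 𝔭) :
    𝔭.LiesOver (Ideal.span {P}) := by
  refine ⟨(isMaximal_span hP).eq_of_le (Ideal.IsPrime.ne_top inferInstance) ?_⟩
  rw [Ideal.span_singleton_le_iff_mem]
  exact hm

include hP in
theorem dvd_iff_mem {𝔭 : Ideal S} (h𝔭 : 𝔭.IsPrime) (hm : algebraMap R S P ∈ 𝔭) (a : R) :
    P ∣ a ↔ algebraMap R S a ∈ 𝔭 := by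
  have := liesOver_span hP h𝔭 hm
  rw [← Ideal.mem_span_singleton, Ideal.mem_of_liesOver 𝔭 (Ideal.span {P})]

include w hP in
theorem prime_of_mem {𝔭 : Ideal S} (h𝔭 : 𝔭.IsPrime) (hm : algebraMap R S P ∈ 𝔭) : Prime 𝔭 := by
  refine Ideal.prime_of_isPrime ?_ h𝔭
  rintro rfl
  exact algebraMap_prime_ne_zero w hP (by simpa using hm)

include w hP in
theorem ramificationIdx_eq_ord {𝔭 : Ideal S} (h𝔭 : 𝔭.IsPrime) (hm : algebraMap R S P ∈ 𝔭) :
    (𝔭.ramificationIdx R : ℕ∞) = ord 𝔭 (algebraMap R S P) := by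
  have := liesOver_span hP h𝔭 hm
  have h0 := algebraMap_prime_ne_zero w hP
  rw [Ideal.IsDedekindDomain.ramificationIdx_eq_multiplicity (Ideal.span {P}) 𝔭
    (by simpa [Ideal.map_span] using h0), Ideal.map_span, Set.image_singleton, ord]
  exact (finiteMultiplicity_iff_emultiplicity_ne_top.mpr
    (ord_ne_top (prime_of_mem w hP h𝔭 hm) h0)).emultiplicity_eq_multiplicity.symm

include w hP in
theorem exists_finset_primes : ∃ U : Finset (Ideal S),
    (∀ 𝔭, 𝔭 ∈ U ↔ 𝔭.IsPrime ∧ algebraMap R S P ∈ 𝔭) ∧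
    ∑ 𝔭 ∈ U, 𝔭.ramificationIdx R * 𝔭.inertiaDeg R = 3 := by
  have := Module.Free.of_basis w
  have := Module.Finite.of_basis w
  have hmax := isMaximal_span hP
  have hbot : Ideal.span {P} ≠ ⊥ := by simpa using hP.ne_zero
  have hfin : (Ideal.span {P}).primesOver S |>.Finite :=
    IsDedekindDomain.primesOver_finite (Ideal.span {P}) S
  let _ := hfin.fintype
  refine ⟨((Ideal.span {P}).primesOver S).toFinset, fun 𝔭 => ?_, ?_⟩
  · rw [Set.mem_toFinset]
    refine ⟨fun ⟨h1, h2⟩ => ⟨h1, ?_⟩, fun ⟨h1, h2⟩ => ⟨h1, liesOver_span hP h1 h2⟩⟩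
    rw [← Ideal.mem_of_liesOver 𝔭 (Ideal.span {P})]
    exact Ideal.mem_span_singleton_self P
  · have h := Ideal.sum_ramification_inertia_eq_finrank (Ideal.span {P}) S
    rw [Module.finrank_eq_card_basis w, Fintype.card_fin] at h
    rw [← h, Finset.sum_set_coe ((Ideal.span {P}).primesOver S)
      (f := fun 𝔭 => 𝔭.ramificationIdx R * 𝔭.inertiaDeg R)]

include w in
theorem ramificationIdx_mul_inertiaDeg_pos {𝔭 : Ideal S} (h𝔭 : 𝔭.IsPrime) :
    0 < 𝔭.ramificationIdx R * 𝔭.inertiaDeg R := by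
  have := Module.Finite.of_basis w
  exact mul_pos (𝔭.ramificationIdx_pos R) (𝔭.inertiaDeg_pos R)

include w hP in
/-- If the primes in a finite set account for the whole degree, then `(P)` is their product. -/
theorem span_eq_prod (T : Finset (Ideal S)) (hT : ∀ 𝔭 ∈ T, 𝔭.IsPrime ∧ algebraMap R S P ∈ 𝔭)
    (h : 3 ≤ ∑ 𝔭 ∈ T, 𝔭.ramificationIdx R * 𝔭.inertiaDeg R) :
    Ideal.span {algebraMap R S P} = ∏ 𝔭 ∈ T, 𝔭 ^ 𝔭.ramificationIdx R ∧
    ∑ 𝔭 ∈ T, 𝔭.ramificationIdx R * 𝔭.inertiaDeg R = 3 := by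
  classical
  obtain ⟨U, hU, hsum⟩ := exists_finset_primes (S := S) w hP
  have hTU : T ⊆ U := fun 𝔭 h𝔭 => (hU 𝔭).mpr (hT 𝔭 h𝔭)
  have hEq : T = U := by
    -- A prime missing from `T` would contribute a positive e f and push the sum above 3.
    by_contra hne
    have := Finset.sum_lt_sum_of_subset (f := fun 𝔭 => 𝔭.ramificationIdx R * 𝔭.inertiaDeg R) hTU
      (Finset.exists_of_ssubset (hTU.ssubset_of_ne hne)).choose_spec.1
      (Finset.exists_of_ssubset (hTU.ssubset_of_ne hne)).choose_spec.2
      (ramificationIdx_mul_inertiaDeg_pos w ((hU _).mp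
        (Finset.exists_of_ssubset (hTU.ssubset_of_ne hne)).choose_spec.1).1)
      (fun _ _ _ => Nat.zero_le _)
    lia
  subst hEq
  refine ⟨?_, hsum⟩
  have h0 : Ideal.span {algebraMap R S P} ≠ ⊥ := by
    simpa using algebraMap_prime_ne_zero (S := S) w hP
  have hmem : (UniqueFactorizationMonoid.normalizedFactors
      (Ideal.span {algebraMap R S P})).toFinset = T := by
    ext 𝔭
    rw [Multiset.mem_toFinset, hU, Ideal.mem_normalizedFactors_iff h0,
      Ideal.span_singleton_le_iff_mem]
  conv_lhs => rw [← Ideal.prod_normalizedFactors_eq_self h0, Finset.prod_multiset_count, hmem]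
  refine Finset.prod_congr rfl fun 𝔭 h𝔭 => ?_
  have := liesOver_span hP (hT 𝔭 h𝔭).1 (hT 𝔭 h𝔭).2
  rw [Ideal.IsDedekindDomain.ramificationIdx_eq_normalizedFactors_count (Ideal.span {P}) 𝔭
    (by simpa [Ideal.map_span] using h0), Ideal.map_span, Set.image_singleton]

include w hP in
-- The sum ∑ e f = 3 is odd.
theorem exists_odd_ramificationIdx : ∃ 𝔭 : Ideal S, 𝔭.IsPrime ∧ algebraMap R S P ∈ 𝔭 ∧
    Odd (𝔭.ramificationIdx R) := by
  obtain ⟨U, hU, hsum⟩ := exists_finset_primes (S := S) w hP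
  by_contra! hno
  have : Even (∑ 𝔭 ∈ U, 𝔭.ramificationIdx R * 𝔭.inertiaDeg R) :=
    Finset.even_sum _ fun 𝔭 h𝔭 => (Nat.not_odd_iff_even.mp
      (hno 𝔭 ((hU 𝔭).mp h𝔭).1 ((hU 𝔭).mp h𝔭).2)).mul_right _
  rw [hsum] at this
  exact absurd this (by decide)

include w hP in
/-- If no residue field above `P` is the base residue field, then `P` stays prime. -/
theorem isPrime_span_of_inertiaDeg_ne_one
    (h : ∀ 𝔭 : Ideal S, 𝔭.IsPrime → algebraMap R S P ∈ 𝔭 → 𝔭.inertiaDeg R ≠ 1) :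
    (Ideal.span {algebraMap R S P}).IsPrime := by
  have := Module.Finite.of_basis w
  obtain ⟨𝔭, h𝔭, hm, hodd⟩ := exists_odd_ramificationIdx (S := S) w hP
  obtain ⟨U, hU, hsum⟩ := exists_finset_primes (S := S) w hP
  -- Every term of ∑ e f = 3 is at least 2, so there is only one prime; then e f = 3 and f ≠ 1 force
  -- e = 1.
  have hf : ∀ 𝔮 ∈ U, 2 ≤ 𝔮.ramificationIdx R * 𝔮.inertiaDeg R := fun 𝔮 h𝔮 => by
    have := (hU 𝔮).mp h𝔮
    have := this.1
    have h1 := h 𝔮 ((hU 𝔮).mp h𝔮).1 ((hU 𝔮).mp h𝔮).2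
    have h2 := 𝔮.inertiaDeg_pos R
    have h3 := 𝔮.ramificationIdx_pos R
    nlinarith [show 2 ≤ 𝔮.inertiaDeg R by lia]
  have hcard : U.card = 1 := by
    have h1 := Finset.card_nsmul_le_sum U _ 2 hf
    have h2 : U.card ≠ 0 := Finset.card_ne_zero_of_mem ((hU 𝔭).mpr ⟨h𝔭, hm⟩)
    rw [hsum, smul_eq_mul] at h1
    lia
  obtain ⟨𝔮, rfl⟩ := Finset.card_eq_one.mp hcard
  obtain ⟨heq, h3⟩ := span_eq_prod w hP {𝔮} (fun 𝔭 h => (hU 𝔭).mp h) hsum.ge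
  obtain rfl : 𝔭 = 𝔮 := by simpa using (hU 𝔭).mpr ⟨h𝔭, hm⟩
  rw [Finset.sum_singleton] at h3
  have he : 𝔭.ramificationIdx R = 1 := by
    have h1 := h 𝔭 h𝔭 hm
    have : 𝔭.ramificationIdx R ∣ 3 := ⟨_, h3.symm⟩
    rcases (Nat.dvd_prime Nat.prime_three).mp this with h4 | h4
    · exact h4
    · rw [h4] at h3
      lia
  rw [heq, Finset.prod_singleton, he, pow_one]
  exact h𝔭

include hP in
theorem exists_sub_mem_of_inertiaDeg_eq_one {𝔭 : Ideal S} (h𝔭 : 𝔭.IsPrime)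
    (hm : algebraMap R S P ∈ 𝔭) (hmax : 𝔭.IsMaximal) (h : 𝔭.inertiaDeg R = 1) (x : S) :
    ∃ c : R, x - algebraMap R S c ∈ 𝔭 := by
  have := liesOver_span hP h𝔭 hm
  have := isMaximal_span hP
  let _ : Field (R ⧸ Ideal.span {P}) := Ideal.Quotient.field _
  rw [Ideal.inertiaDeg_eq_of_isMaximal (Ideal.span {P}) 𝔭] at h
  obtain ⟨c, hc⟩ := (Algebra.finrank_eq_one_iff_bijective_algebraMap.mp h).2 (Ideal.Quotient.mk 𝔭 x)
  obtain ⟨c, rfl⟩ := Ideal.Quotient.mk_surjective c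
  refine ⟨c, ?_⟩
  rw [← Ideal.Quotient.mk_eq_mk_iff_sub_mem, ← hc]
  rfl

end Decomposition

/-! ### Discriminants under change of basis, and traces -/

section Discriminant

variable {R S : Type*} [CommRing R] [CommRing S] [Algebra R S]

/-- The transition matrix from (1, z, t) to (1, z, z²) has determinant `p`. This measures what is
gained by dividing a monic quadratic in `z` by `p`. -/
theorem discr_powers_eq (z t : S) (α β p : R)
    (h : z ^ 2 = algebraMap R S α + algebraMap R S β * z + algebraMap R S p * t) :
    Algebra.discr R ![1, z, z ^ 2] = p ^ 2 * Algebra.discr R ![1, z, t] := by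
  have hd : (!![1, 0, 0; 0, 1, 0; α, β, p] : Matrix (Fin 3) (Fin 3) R).det = p := by
    simp [Matrix.det_fin_three]
  conv_rhs => rw [← hd, ← Algebra.discr_of_matrix_mulVec]
  congr 1
  ext i
  fin_cases i <;> simp [Matrix.mulVec, dotProduct, Fin.sum_univ_three, h]

theorem discr_powers_sub (z : S) (c : R) :
    Algebra.discr R ![1, z - algebraMap R S c, (z - algebraMap R S c) ^ 2] =
      Algebra.discr R ![1, z, z ^ 2] := by
  have hd : (!![1, 0, 0; -c, 1, 0; c ^ 2, -2 * c, 1] : Matrix (Fin 3) (Fin 3) R).det = 1 := by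
    simp [Matrix.det_fin_three]
  conv_rhs => rw [← one_mul (Algebra.discr R _), ← one_pow 2, ← hd, ← Algebra.discr_of_matrix_mulVec]
  congr 1
  ext i
  fin_cases i <;> simp [Matrix.mulVec, dotProduct, Fin.sum_univ_three, map_ofNat] <;> ring

theorem discr_powers_mul (t : S) (p : R) :
    Algebra.discr R ![1, algebraMap R S p * t, (algebraMap R S p * t) ^ 2] =
      p ^ 6 * Algebra.discr R ![1, t, t ^ 2] := by
  have hd : (!![1, 0, 0; 0, p, 0; 0, 0, p ^ 2] : Matrix (Fin 3) (Fin 3) R).det = p ^ 3 := by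
    simp [Matrix.det_fin_three]
    ring
  rw [show p ^ 6 = (p ^ 3) ^ 2 by ring, ← hd, ← Algebra.discr_of_matrix_mulVec]
  congr 1
  ext i
  fin_cases i <;> simp [Matrix.mulVec, dotProduct, Fin.sum_univ_three, mul_pow]

theorem exists_discr_eq (w : Module.Basis (Fin 3) R S) (b : Fin 3 → S) :
    ∃ J : R, Algebra.discr R b = J ^ 2 * Algebra.discr R w := by
  refine ⟨(w.toMatrix b).det, ?_⟩
  rw [← Algebra.discr_of_matrix_vecMul, Module.Basis.toMatrix_map_vecMul]

/-- Multiplication by `x` is nilpotent modulo `P`, and a nilpotent matrix over a domain has trace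
zero. -/
theorem dvd_trace_of_pow_dvd [IsDomain R] (w : Module.Basis (Fin 3) R S) {P : R} (hP : Prime P)
    {x : S} {n : ℕ} (h : algebraMap R S P ∣ x ^ n) : P ∣ Algebra.trace R S x := by
  have : (Ideal.span {P}).IsPrime := (Ideal.span_singleton_prime hP.ne_zero).mpr hP
  obtain ⟨t, ht⟩ := h
  have hn : IsNilpotent ((Ideal.Quotient.mk (Ideal.span {P})).mapMatrix
      (Algebra.leftMulMatrix w x)) := by
    refine ⟨n, ?_⟩
    rw [← map_pow, ← map_pow, ht, map_mul, map_mul, AlgHom.commutes]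
    convert zero_mul _
    ext i j
    rw [RingHom.mapMatrix_apply, Matrix.map_apply, Matrix.algebraMap_matrix_apply]
    split_ifs
    · simp
    · simp
  have := (Matrix.isNilpotent_trace_of_isNilpotent hn).eq_zero
  rw [← Ideal.mem_span_singleton, ← Ideal.Quotient.eq_zero_iff_mem, ← this,
    Algebra.trace_eq_matrix_trace w, RingHom.mapMatrix_apply]
  simp [Matrix.trace, Fin.sum_univ_three]

theorem pow_three_dvd_discr (w : Module.Basis (Fin 3) R S) {P : R}
    (h : ∀ x, P ∣ Algebra.trace R S x) : P ^ 3 ∣ Algebra.discr R w := by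
  choose f hf using fun i j => h (w i * w j)
  have : Algebra.traceMatrix R w = P • Matrix.of f := by
    ext i j
    simp [Algebra.traceMatrix_apply, Algebra.traceForm_apply, hf]
  rw [Algebra.discr_def, this, Matrix.det_smul, Fintype.card_fin]
  exact dvd_mul_right _ _

end Discriminant

/-! ### Ramified primes, by Newton polygons -/

section Ramified

variable {R S : Type*} [CommRing R] [IsDomain R] [IsPrincipalIdealRing R]
  [CommRing S] [IsDedekindDomain S] [Algebra R S] (w : Module.Basis (Fin 3) R S)
  {P : R} (hP : Prime P)

include w hP in
theorem ord_algebraMap_of_not_dvd {𝔭 : Ideal S} (h𝔭 : 𝔭.IsPrime) (hm : algebraMap R S P ∈ 𝔭)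
    {a : R} (m : ℕ) (ha : ¬ P ∣ a) :
    ord 𝔭 (algebraMap R S (P ^ m * a)) = m * 𝔭.ramificationIdx R := by
  have hp := prime_of_mem w hP h𝔭 hm
  rw [map_mul, map_pow, ord_mul hp, ord_pow hp, ramificationIdx_eq_ord w hP h𝔭 hm,
    ord_eq_zero_iff.mpr ((dvd_iff_mem hP h𝔭 hm a).not.mp ha), add_zero]

include w hP in
theorem le_ord_algebraMap_of_dvd {𝔭 : Ideal S} (h𝔭 : 𝔭.IsPrime) (hm : algebraMap R S P ∈ 𝔭)
    {a : R} {m : ℕ} (ha : P ^ m ∣ a) :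
    m * 𝔭.ramificationIdx R ≤ ord 𝔭 (algebraMap R S a) := by
  obtain ⟨a, rfl⟩ := ha
  have hp := prime_of_mem w hP h𝔭 hm
  rw [map_mul, map_pow, ord_mul hp, ord_pow hp, ramificationIdx_eq_ord w hP h𝔭 hm]
  exact le_self_add

include w hP in
theorem exists_prime_mem : ∃ 𝔭 : Ideal S, 𝔭.IsPrime ∧ 𝔭.IsMaximal ∧ algebraMap R S P ∈ 𝔭 := by
  obtain ⟨𝔭, h𝔭, hm, -⟩ := exists_odd_ramificationIdx (S := S) w hP
  exact ⟨𝔭, h𝔭, h𝔭.isMaximal (prime_of_mem w hP h𝔭 hm).ne_zero, hm⟩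

include w hP in
/-- If the Newton polygon has a single slope with denominator `3`, then `P` is totally ramified. -/
theorem span_eq_pow_three (h3 : (3 : R) = 0) {A B : R} {z : S}
    (hz : z ^ 3 - algebraMap R S A * z + algebraMap R S B = 0) {m : ℕ} (hm3 : ¬ 3 ∣ m)
    (hA : P ^ m ∣ A) (hB : P ^ m ∣ B) (hB' : ¬ P ^ (m + 1) ∣ B) :
    (∃ 𝔭 : Ideal S, 𝔭.IsPrime ∧ Ideal.span {algebraMap R S P} = 𝔭 ^ 3) ∧
      P ^ 3 ∣ Algebra.discr R w := by
  have := Module.Finite.of_basis w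
  obtain ⟨𝔭, h𝔭, hmax, hm⟩ := exists_prime_mem (S := S) w hP
  have hp := prime_of_mem w hP h𝔭 hm
  have he := 𝔭.ramificationIdx_pos R
  have hf := 𝔭.inertiaDeg_pos R
  have hdvd : 3 ∣ 𝔭.ramificationIdx R := by
    have hm0 : m ≠ 0 := by
      rintro rfl
      exact hm3 (dvd_zero 3)
    have hAm := le_ord_algebraMap_of_dvd w hP h𝔭 hm hA
    obtain ⟨B₁, rfl⟩ := hB
    have hB₁ : ¬ P ∣ B₁ := fun h => hB' (by rw [pow_succ]; exact mul_dvd_mul_left _ h)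
    have hBm := ord_algebraMap_of_not_dvd w hP h𝔭 hm m hB₁
    have hz' : z ^ 3 = -algebraMap R S (P ^ m * B₁) + algebraMap R S A * z := by
      linear_combination hz
    have hAmem : algebraMap R S A ∈ 𝔭 :=
      (dvd_iff_mem hP h𝔭 hm A).mp ((dvd_pow_self P hm0).trans hA)
    have hBmem : algebraMap R S (P ^ m * B₁) ∈ 𝔭 :=
      (dvd_iff_mem hP h𝔭 hm _).mp ((dvd_pow_self P hm0).mul_right _)
    have hzmem : z ∈ 𝔭 := h𝔭.mem_of_pow_mem 3 (by
      rw [hz']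
      exact add_mem (neg_mem hBmem) (Ideal.mul_mem_right _ _ hAmem))
    -- As `z` lies in `𝔭`, the constant term strictly dominates A z. So 3 ord z = m e, and 3 ∤ m
    -- gives 3 ∣ e.
    have hlt : ord 𝔭 (-algebraMap R S (P ^ m * B₁)) < ord 𝔭 (algebraMap R S A * z) := by
      rw [ord_neg, hBm, ord_mul hp]
      refine lt_of_lt_of_le ?_ (add_le_add hAm (ord_pos_iff.mpr hzmem))
      exact_mod_cast Nat.lt_succ_self _
    have hord := ord_add_of_lt hlt
    rw [← hz', ord_neg, hBm, ord_pow hp] at hord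
    obtain ⟨n, hn⟩ := ENat.ne_top_iff_exists.mp
      (show ord 𝔭 z ≠ ⊤ by
        intro h'
        rw [h', ENat.mul_top (by norm_num)] at hord
        exact absurd hord.symm (by exact_mod_cast ENat.natCast_ne_top _))
    rw [← hn] at hord
    have hnat : 3 * n = m * 𝔭.ramificationIdx R := by exact_mod_cast hord
    exact (Nat.prime_three.dvd_mul.mp ⟨n, hnat.symm⟩).resolve_left hm3
  have hle : 3 ≤ 𝔭.ramificationIdx R := Nat.le_of_dvd he hdvd
  obtain ⟨heq, hsum⟩ := span_eq_prod (S := S) w hP {𝔭} (by simp [h𝔭, hm])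
    (by rw [Finset.sum_singleton]; nlinarith)
  rw [Finset.sum_singleton] at hsum
  rw [Finset.prod_singleton] at heq
  have hf1 : 𝔭.inertiaDeg R = 1 := by nlinarith
  rw [hf1, mul_one] at hsum
  rw [hsum] at heq
  refine ⟨⟨𝔭, h𝔭, heq⟩, pow_three_dvd_discr w fun x => ?_⟩
  -- Wild ramification: (x - c)³ lies in 𝔭³ = (P), so `P` divides tr(x - c) = tr x - 3c = tr x.
  obtain ⟨c, hc⟩ := exists_sub_mem_of_inertiaDeg_eq_one hP h𝔭 hm hmax hf1 x
  have h1 : P ∣ Algebra.trace R S (x - algebraMap R S c) := by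
    refine dvd_trace_of_pow_dvd w hP (n := 3) ?_
    rw [← Ideal.mem_span_singleton, heq]
    exact Ideal.pow_mem_pow hc 3
  rwa [map_sub, Algebra.trace_algebraMap_of_basis w, Fintype.card_fin, nsmul_eq_mul,
    Nat.cast_ofNat, h3, zero_mul, sub_zero] at h1

include w hP in
/-- If the Newton polygon has a segment of slope `1 / 2`, then `P` is partially ramified. -/
theorem span_eq_mul_sq {A B : R} {z : S}
    (hz : z ^ 3 - algebraMap R S A * z + algebraMap R S B = 0)
    (hd : Algebra.discr R ![1, z, z ^ 2] = A ^ 3)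
    (hA : P ∣ A) (hA' : ¬ P ^ 2 ∣ A) (hB : P ^ 2 ∣ B) :
    (∃ 𝔭 𝔮 : Ideal S, 𝔭.IsPrime ∧ 𝔮.IsPrime ∧ 𝔭 ≠ 𝔮 ∧
      Ideal.span {algebraMap R S P} = 𝔮 * 𝔭 ^ 2) ∧
      emultiplicity P (Algebra.discr R w) = 1 := by
  classical
  have := Module.Finite.of_basis w
  have h0 := algebraMap_prime_ne_zero (S := S) w hP
  obtain ⟨A₁, rfl⟩ := hA
  have hA₁ : ¬ P ∣ A₁ := fun h => hA' (by rw [pow_two]; exact mul_dvd_mul_left P h)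
  -- If ord z < e, then ord(A z) = e + ord z < 2e ≤ ord B, so 3 ord z = e + ord z.
  have key : ∀ 𝔭 : Ideal S, 𝔭.IsPrime → algebraMap R S P ∈ 𝔭 →
      (𝔭.ramificationIdx R : ℕ∞) ≤ ord 𝔭 z ∨ (𝔭.ramificationIdx R : ℕ∞) = 2 * ord 𝔭 z := by
    intro 𝔭 h𝔭 hm
    have hp := prime_of_mem w hP h𝔭 hm
    rw [or_iff_not_imp_left, not_le]
    intro hlt
    have hAm := ord_algebraMap_of_not_dvd w hP h𝔭 hm 1 hA₁
    have hBm := le_ord_algebraMap_of_dvd w hP h𝔭 hm hB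
    rw [pow_one, Nat.cast_one, one_mul] at hAm
    obtain ⟨n, hn⟩ := ENat.ne_top_iff_exists.mp hlt.ne_top
    rw [← hn] at hlt ⊢
    have hlt' : n < 𝔭.ramificationIdx R := by exact_mod_cast hlt
    have hz' : z ^ 3 = algebraMap R S (P * A₁) * z + -algebraMap R S B := by
      linear_combination hz
    have hord : ord 𝔭 (z ^ 3) = 𝔭.ramificationIdx R + n := by
      rw [hz', ord_add_of_lt, ord_mul hp, hAm, hn]
      rw [ord_neg, ord_mul hp, hAm, ← hn]
      refine lt_of_lt_of_le ?_ hBm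
      norm_cast
      lia
    rw [ord_pow hp, ← hn] at hord
    norm_cast at hord ⊢
    lia
  have hdvd : algebraMap R S P ∣ z ^ 2 := by
    refine dvd_of_ord_le h0 fun 𝔭 hp hm => ?_
    rw [ord_pow hp, ← ramificationIdx_eq_ord w hP (Ideal.isPrime_of_prime hp) hm]
    rcases key 𝔭 (Ideal.isPrime_of_prime hp) hm with h | h
    · refine h.trans ?_
      push_cast
      rw [two_mul]
      exact le_self_add
    · exact h.le
  obtain ⟨u, hu⟩ := hdvd
  constructor
  · obtain ⟨𝔮, h𝔮, hm𝔮, hodd⟩ := exists_odd_ramificationIdx (S := S) w hP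
    -- If every e were odd, `key` would give z = P t with `t` integral, so P⁶ would divide A³,
    -- against v(A) = 1.
    have hex : ∃ 𝔭 : Ideal S, 𝔭.IsPrime ∧ algebraMap R S P ∈ 𝔭 ∧ Even (𝔭.ramificationIdx R) := by
      by_contra! hno
      have hPz : algebraMap R S P ∣ z := by
        refine dvd_of_ord_le h0 fun 𝔭 hp hm => ?_
        have hp' := Ideal.isPrime_of_prime hp
        rw [← ramificationIdx_eq_ord w hP hp' hm]
        refine (key 𝔭 hp' hm).resolve_right fun h => hno 𝔭 hp' hm ?_
        obtain ⟨n, hn⟩ := ENat.ne_top_iff_exists.mp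
          (show ord 𝔭 z ≠ ⊤ by rintro h'; rw [h'] at h; simp at h)
        rw [← hn] at h
        exact ⟨n, by rw [← two_mul]; exact_mod_cast h⟩
      obtain ⟨t, rfl⟩ := hPz
      rw [discr_powers_mul] at hd
      have h1 : P ^ 3 * (P ^ 3 * Algebra.discr R ![1, t, t ^ 2]) = P ^ 3 * A₁ ^ 3 := by
        linear_combination hd
      have h2 := mul_left_cancel₀ (pow_ne_zero 3 hP.ne_zero) h1
      refine hA₁ (hP.dvd_of_dvd_pow (n := 3) ?_)
      rw [← h2, pow_succ', mul_assoc]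
      exact dvd_mul_right _ _
    obtain ⟨𝔭, h𝔭, hm𝔭, heven⟩ := hex
    have hne : 𝔭 ≠ 𝔮 := by
      rintro rfl
      exact Nat.not_even_iff_odd.mpr hodd heven
    have he𝔭 := 𝔭.ramificationIdx_pos R
    have hf𝔭 := 𝔭.inertiaDeg_pos R
    have h𝔮pos := ramificationIdx_mul_inertiaDeg_pos (R := R) w h𝔮
    obtain ⟨n, hn⟩ := heven
    have h2le : 2 ≤ 𝔭.ramificationIdx R * 𝔭.inertiaDeg R := by
      nlinarith [show 2 ≤ 𝔭.ramificationIdx R by lia]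
    obtain ⟨heq, hsum⟩ := span_eq_prod (S := S) w hP {𝔭, 𝔮} (by simp [h𝔭, hm𝔭, h𝔮, hm𝔮])
      (by rw [Finset.sum_pair hne]; lia)
    rw [Finset.sum_pair hne] at hsum
    rw [Finset.prod_pair hne] at heq
    have hq1 : 𝔮.ramificationIdx R = 1 ∧ 𝔮.inertiaDeg R = 1 := by
      rw [← mul_eq_one]
      lia
    have hp2 : 𝔭.ramificationIdx R = 2 := by
      have : 𝔭.ramificationIdx R * 𝔭.inertiaDeg R = 2 := by
        rw [hq1.1, hq1.2] at hsum
        lia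
      have : 𝔭.ramificationIdx R ≤ 2 := Nat.le_of_dvd two_pos ⟨_, this.symm⟩
      lia
    refine ⟨𝔭, 𝔮, h𝔭, h𝔮, hne, ?_⟩
    rw [heq, hp2, hq1.1, pow_one, mul_comm]
  -- Since z² = P u, disc(1, z, u) = A³ / P² has valuation 1, too small for `P` to divide the index
  -- `J`.
  · obtain ⟨J, hJ⟩ := exists_discr_eq w ![1, z, u]
    rw [discr_powers_eq z u 0 0 P (by simp [hu]), hJ] at hd
    have h1 : P ^ 2 * (J ^ 2 * Algebra.discr R w) = P ^ 2 * (P * A₁ ^ 3) := by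
      linear_combination hd
    have h2 := mul_left_cancel₀ (pow_ne_zero 2 hP.ne_zero) h1
    have h3 : emultiplicity P (J ^ 2 * Algebra.discr R w) = 1 := by
      rw [h2, emultiplicity_mul hP, emultiplicity_pow hP, emultiplicity_eq_zero.mpr hA₁, mul_zero,
        add_zero]
      have := (FiniteMultiplicity.of_prime_left hP hP.ne_zero).emultiplicity_self
      exact this
    have hPJ : ¬ P ∣ J := by
      rintro ⟨J, rfl⟩
      rw [← Nat.cast_one, emultiplicity_eq_coe] at h3
      exact h3.2 ⟨J ^ 2 * Algebra.discr R w, by ring⟩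
    rwa [emultiplicity_mul hP, emultiplicity_pow hP, emultiplicity_eq_zero.mpr hPJ, mul_zero,
      zero_add] at h3

end Ramified

/-! ### Unramified primes, by factoring the cubic modulo the prime -/

section Unramified

variable {R S : Type*} [CommRing R] [IsDomain R] [IsPrincipalIdealRing R]
  [CommRing S] [IsDedekindDomain S] [Algebra R S] (w : Module.Basis (Fin 3) R S)
  {P : R} (hP : Prime P) {A B : R} {z : S}

include hP in
-- An integral quotient by `P` would make A³ divisible by P². This replaces the statement that `z`
-- generates the ring locally at `P`.
theorem not_dvd_quadratic (hd : Algebra.discr R ![1, z, z ^ 2] = A ^ 3) (hA : ¬ P ∣ A) (α β : R) :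
    ¬ algebraMap R S P ∣ z ^ 2 + algebraMap R S β * z + algebraMap R S α := by
  rintro ⟨t, ht⟩
  rw [discr_powers_eq z t (-α) (-β) P (by rw [map_neg, map_neg]; linear_combination ht)] at hd
  exact hA (hP.dvd_of_dvd_pow (hd ▸ (dvd_pow_self P two_ne_zero).mul_right _))

include hP in
theorem exists_prime_linear_mem (hd : Algebra.discr R ![1, z, z ^ 2] = A ^ 3) (hA : ¬ P ∣ A)
    (c α β : R) (h : algebraMap R S P ∣
      (z - algebraMap R S c) * (z ^ 2 + algebraMap R S β * z + algebraMap R S α)) :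
    ∃ 𝔭 : Ideal S, 𝔭.IsPrime ∧ algebraMap R S P ∈ 𝔭 ∧ z - algebraMap R S c ∈ 𝔭 := by
  by_contra! hno
  exact not_dvd_quadratic hP hd hA α β (dvd_right_of_dvd_mul h hno)

include hP in
theorem exists_prime_quadratic_mem (hd : Algebra.discr R ![1, z, z ^ 2] = A ^ 3) (hA : ¬ P ∣ A)
    (c α β : R) (h : algebraMap R S P ∣
      (z - algebraMap R S c) * (z ^ 2 + algebraMap R S β * z + algebraMap R S α)) :
    ∃ 𝔭 : Ideal S, 𝔭.IsPrime ∧ algebraMap R S P ∈ 𝔭 ∧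
      z ^ 2 + algebraMap R S β * z + algebraMap R S α ∈ 𝔭 := by
  by_contra! hno
  rw [mul_comm] at h
  -- If `P` divided z - c, it would divide the monic quadratic z (z - c).
  refine not_dvd_quadratic hP hd hA 0 (-c) ((dvd_right_of_dvd_mul h hno).trans ⟨z, ?_⟩)
  rw [map_zero, map_neg]
  ring

include hP in
theorem dvd_eval_of_sub_mem (hz : z ^ 3 - algebraMap R S A * z + algebraMap R S B = 0)
    {𝔭 : Ideal S} (h𝔭 : 𝔭.IsPrime) (hm : algebraMap R S P ∈ 𝔭) {c : R}
    (hc : z - algebraMap R S c ∈ 𝔭) : P ∣ c ^ 3 - A * c + B := by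
  rw [dvd_iff_mem hP h𝔭 hm]
  convert 𝔭.mul_mem_left (-(z ^ 2 + z * algebraMap R S c + algebraMap R S c ^ 2 - algebraMap R S A))
    hc using 1
  simp only [map_add, map_sub, map_mul, map_pow]
  linear_combination hz

include w hP in
/-- If the cubic has no root modulo `P`, then `P` is inert. -/
theorem isPrime_span (hz : z ^ 3 - algebraMap R S A * z + algebraMap R S B = 0)
    (hno : ∀ c : R, ¬ P ∣ c ^ 3 - A * c + B) : (Ideal.span {algebraMap R S P}).IsPrime := by
  refine isPrime_span_of_inertiaDeg_ne_one w hP fun 𝔭 h𝔭 hm h1 => ?_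
  obtain ⟨c, hc⟩ := exists_sub_mem_of_inertiaDeg_eq_one hP h𝔭 hm
    (h𝔭.isMaximal (prime_of_mem w hP h𝔭 hm).ne_zero) h1 z
  exact hno c (dvd_eval_of_sub_mem hP hz h𝔭 hm hc)

include w hP in
/-- If the cubic has exactly one root modulo `P`, then `P` splits into two primes. -/
theorem span_eq_mul (h3 : (3 : R) = 0)
    (hz : z ^ 3 - algebraMap R S A * z + algebraMap R S B = 0)
    (hd : Algebra.discr R ![1, z, z ^ 2] = A ^ 3) (hA : ¬ P ∣ A) {c : R}
    (hc : P ∣ c ^ 3 - A * c + B) (huniq : ∀ d : R, P ∣ d ^ 3 - A * d + B → P ∣ d - c) :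
    ∃ 𝔭 𝔮 : Ideal S, 𝔭.IsPrime ∧ 𝔮.IsPrime ∧ 𝔭 ≠ 𝔮 ∧
      Ideal.span {algebraMap R S P} = 𝔭 * 𝔮 := by
  classical
  have := Module.Finite.of_basis w
  have h3S : (3 : S) = 0 := by
    rw [← map_ofNat (algebraMap R S) 3, h3, map_zero]
  have hdvd : algebraMap R S P ∣ (z - algebraMap R S c) *
      (z ^ 2 + algebraMap R S c * z + algebraMap R S (c ^ 2 - A)) := by
    obtain ⟨t, ht⟩ := hc
    refine ⟨-algebraMap R S t, ?_⟩
    have ht' := congrArg (algebraMap R S) ht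
    simp only [map_add, map_sub, map_mul, map_pow] at ht' ⊢
    linear_combination hz - ht'
  obtain ⟨𝔭, h𝔭, hm𝔭, hx𝔭⟩ := exists_prime_linear_mem hP hd hA _ _ _ hdvd
  obtain ⟨𝔮, h𝔮, hm𝔮, hx𝔮⟩ := exists_prime_quadratic_mem hP hd hA _ _ _ hdvd
  -- In characteristic three the quadratic factor is (z - c)² - A, so a prime containing both
  -- factors contains `A`.
  have hnot : z - algebraMap R S c ∉ 𝔮 := by
    intro h
    refine hA ((dvd_iff_mem hP h𝔮 hm𝔮 A).mpr ?_)
    convert 𝔮.sub_mem (𝔮.mul_mem_left (z - algebraMap R S c) h) hx𝔮 using 1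
    simp only [map_sub, map_pow]
    linear_combination algebraMap R S c * z * h3S
  have hne : 𝔭 ≠ 𝔮 := by
    rintro rfl
    exact hnot hx𝔭
  -- Were f = 1, `z` would be congruent modulo `𝔮` to a root in `R`, hence to `c` by uniqueness.
  have hf : 𝔮.inertiaDeg R ≠ 1 := by
    intro h1
    obtain ⟨d, hd⟩ := exists_sub_mem_of_inertiaDeg_eq_one hP h𝔮 hm𝔮
      (h𝔮.isMaximal (prime_of_mem w hP h𝔮 hm𝔮).ne_zero) h1 z
    have h2 := (dvd_iff_mem hP h𝔮 hm𝔮 _).mp (huniq d (dvd_eval_of_sub_mem hP hz h𝔮 hm𝔮 hd))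
    refine hnot ?_
    convert add_mem hd h2 using 1
    rw [map_sub]
    ring
  have he𝔭 := 𝔭.ramificationIdx_pos R
  have hf𝔭 := 𝔭.inertiaDeg_pos R
  have he𝔮 := 𝔮.ramificationIdx_pos R
  have hf𝔮 := 𝔮.inertiaDeg_pos R
  have hf2 : 2 ≤ 𝔮.inertiaDeg R := by lia
  have h1 : 𝔭.ramificationIdx R ≤ 𝔭.ramificationIdx R * 𝔭.inertiaDeg R :=
    Nat.le_mul_of_pos_right _ hf𝔭
  have h2 : 𝔮.ramificationIdx R * 2 ≤ 𝔮.ramificationIdx R * 𝔮.inertiaDeg R :=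
    Nat.mul_le_mul_left _ hf2
  obtain ⟨heq, hsum⟩ := span_eq_prod (S := S) w hP {𝔭, 𝔮} (by simp [h𝔭, hm𝔭, h𝔮, hm𝔮])
    (by rw [Finset.sum_pair hne]; lia)
  rw [Finset.sum_pair hne] at hsum
  rw [Finset.prod_pair hne] at heq
  refine ⟨𝔭, 𝔮, h𝔭, h𝔮, hne, ?_⟩
  rw [heq, show 𝔭.ramificationIdx R = 1 by lia, show 𝔮.ramificationIdx R = 1 by lia, pow_one,
    pow_one]

include w hP in
/-- If the cubic has a root and `A` is a non-zero square modulo `P`, then `P` splits completely. -/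
theorem span_eq_mul_mul (h3 : (3 : R) = 0)
    (hz : z ^ 3 - algebraMap R S A * z + algebraMap R S B = 0)
    (hd : Algebra.discr R ![1, z, z ^ 2] = A ^ 3) (hA : ¬ P ∣ A) {c δ : R}
    (hc : P ∣ c ^ 3 - A * c + B) (hδ : P ∣ δ ^ 2 - A) :
    ∃ 𝔭 𝔮 𝔯 : Ideal S, 𝔭.IsPrime ∧ 𝔮.IsPrime ∧ 𝔯.IsPrime ∧ 𝔭 ≠ 𝔮 ∧ 𝔭 ≠ 𝔯 ∧ 𝔮 ≠ 𝔯 ∧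
      Ideal.span {algebraMap R S P} = 𝔭 * 𝔮 * 𝔯 := by
  classical
  have := Module.Finite.of_basis w
  have h3S : (3 : S) = 0 := by
    rw [← map_ofNat (algebraMap R S) 3, h3, map_zero]
  have hPδ : ¬ P ∣ δ := fun h => hA ((dvd_sub_right (h.trans (dvd_pow_self δ two_ne_zero))).mp hδ)
  -- The kernel of T ↦ T³ - aT is {0, δ, -δ}, so the roots modulo `P` are c, c + δ and c - δ.
  have hdvd : algebraMap R S P ∣ (z - algebraMap R S c) * (z - algebraMap R S (c + δ)) *
      (z - algebraMap R S (c - δ)) := by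
    obtain ⟨t, ht⟩ := hc
    obtain ⟨s, hs⟩ := hδ
    refine ⟨-algebraMap R S t - algebraMap R S s * (z - algebraMap R S c), ?_⟩
    have ht' := congrArg (algebraMap R S) ht
    have hs' := congrArg (algebraMap R S) hs
    simp only [map_add, map_sub, map_mul, map_pow] at ht' hs' ⊢
    linear_combination hz - ht' - hs' * (z - algebraMap R S c) +
      (algebraMap R S c ^ 2 * z - algebraMap R S c * z ^ 2) * h3S
  obtain ⟨𝔭, h𝔭, hm𝔭, hx𝔭⟩ := exists_prime_linear_mem hP hd hA c
    ((c + δ) * (c - δ)) (-(2 * c)) (by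
      convert hdvd using 1
      simp only [map_add, map_sub, map_mul, map_neg, map_ofNat]
      ring)
  obtain ⟨𝔮, h𝔮, hm𝔮, hx𝔮⟩ := exists_prime_linear_mem hP hd hA (c + δ)
    (c * (c - δ)) (δ - 2 * c) (by
      convert hdvd using 1
      simp only [map_add, map_sub, map_mul, map_ofNat]
      ring)
  obtain ⟨𝔯, h𝔯, hm𝔯, hx𝔯⟩ := exists_prime_linear_mem hP hd hA (c - δ)
    (c * (c + δ)) (-δ - 2 * c) (by
      convert hdvd using 1
      simp only [map_add, map_sub, map_mul, map_neg, map_ofNat]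
      ring)
  have hpq : 𝔭 ≠ 𝔮 := by
    rintro rfl
    refine hPδ ((dvd_iff_mem hP h𝔭 hm𝔭 δ).mpr ?_)
    convert 𝔭.sub_mem hx𝔭 hx𝔮 using 1
    rw [map_add]
    ring
  have hpr : 𝔭 ≠ 𝔯 := by
    rintro rfl
    refine hPδ ((dvd_iff_mem hP h𝔭 hm𝔭 δ).mpr ?_)
    convert 𝔭.sub_mem hx𝔯 hx𝔭 using 1
    rw [map_sub]
    ring
  have hqr : 𝔮 ≠ 𝔯 := by
    rintro rfl
    refine hPδ ((dvd_iff_mem hP h𝔮 hm𝔮 δ).mpr ?_)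
    convert 𝔮.sub_mem hx𝔮 hx𝔯 using 1
    rw [map_sub, map_add]
    linear_combination algebraMap R S δ * h3S
  have h1 := ramificationIdx_mul_inertiaDeg_pos (R := R) w h𝔭
  have h2 := ramificationIdx_mul_inertiaDeg_pos (R := R) w h𝔮
  have h4 := ramificationIdx_mul_inertiaDeg_pos (R := R) w h𝔯
  have hsplit : ∀ f : Ideal S → ℕ, ∑ 𝔞 ∈ {𝔭, 𝔮, 𝔯}, f 𝔞 = f 𝔭 + (f 𝔮 + f 𝔯) := fun f => by
    rw [Finset.sum_insert (by simp [hpq, hpr]), Finset.sum_pair hqr]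
  obtain ⟨heq, hsum⟩ := span_eq_prod (S := S) w hP {𝔭, 𝔮, 𝔯}
    (by simp [h𝔭, hm𝔭, h𝔮, hm𝔮, h𝔯, hm𝔯]) (by rw [hsplit]; lia)
  rw [hsplit] at hsum
  rw [Finset.prod_insert (by simp [hpq, hpr]), Finset.prod_pair hqr] at heq
  have e1 : 𝔭.ramificationIdx R = 1 := (mul_eq_one.mp (by lia :
    𝔭.ramificationIdx R * 𝔭.inertiaDeg R = 1)).1
  have e2 : 𝔮.ramificationIdx R = 1 := (mul_eq_one.mp (by lia :
    𝔮.ramificationIdx R * 𝔮.inertiaDeg R = 1)).1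
  have e3 : 𝔯.ramificationIdx R = 1 := (mul_eq_one.mp (by lia :
    𝔯.ramificationIdx R * 𝔯.inertiaDeg R = 1)).1
  refine ⟨𝔭, 𝔮, 𝔯, h𝔭, h𝔮, h𝔯, hpq, hpr, hqr, ?_⟩
  rw [heq, e1, e2, e3, pow_one, pow_one, pow_one, mul_assoc]

end Unramified

/-! ### The cubic over a field and its discriminant -/

section Cubic

variable {R : Type*} [CommRing R]

theorem cubic_monic [Nontrivial R] (a b : R) : (cubic a b).Monic := by
  unfold cubic
  monicity!

theorem natDegree_cubic [Nontrivial R] (a b : R) : (cubic a b).natDegree = 3 := by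
  unfold cubic
  compute_degree!

theorem eval_cubic (a b c : R) : (cubic a b).eval c = c ^ 3 - a * c + b := by
  simp [cubic]

theorem map_cubic {S : Type*} [CommRing S] (φ : R →+* S) (a b : R) :
    (cubic a b).map φ = cubic (φ a) (φ b) := by
  simp [cubic]

theorem aeval_cubic {S : Type*} [CommRing S] [Algebra R S] (a b : R) (z : S) :
    aeval z (cubic a b) = z ^ 3 - algebraMap R S a * z + algebraMap R S b := by
  simp [cubic]

theorem derivative_cubic (h3 : (3 : R) = 0) (a b : R) : derivative (cubic a b) = C (-a) := by
  have h : (C 2 + 1 : R[X]) = 0 := by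
    rw [← C_1, ← C_add, show (2 + 1 : R) = 0 by linear_combination h3, C_0]
  simp [cubic, h]

theorem separable_cubic {K : Type*} [Field K] (h3 : (3 : K) = 0) {a : K} (ha : a ≠ 0) (b : K) :
    (cubic a b).Separable := by
  rw [separable_def, derivative_cubic h3]
  exact ⟨0, C (-a)⁻¹, by
    rw [zero_mul, zero_add, ← C_mul, inv_mul_cancel₀ (neg_ne_zero.mpr ha), C_1]⟩

theorem isSeparable_of_adjoin_eq_top {K L : Type*} [Field K] [Field L] [Algebra K L]
    (h3 : (3 : K) = 0) {a b : K} (ha : a ≠ 0) {y : L} (hy : aeval y (cubic a b) = 0)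
    (htop : IntermediateField.adjoin K {y} = ⊤) : Algebra.IsSeparable K L := by
  have hs : IsSeparable K y := (separable_cubic h3 ha b).of_dvd (minpoly.dvd K y hy)
  have h := (IntermediateField.isSeparable_adjoin_simple_iff_isSeparable K L).mpr hs
  rw [htop] at h
  exact Algebra.IsSeparable.of_algHom K _ (IntermediateField.topEquiv (F := K) (E := L)).symm.toAlgHom

/-- The discriminant of the power basis is -N(f'(y)) = -N(-a) = a³. -/
theorem discr_powers_field {K L : Type*} [Field K] [Field L] [Algebra K L]
    (h3 : (3 : K) = 0) {a b : K} (ha : a ≠ 0) {y : L} (hy : aeval y (cubic a b) = 0)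
    (htop : IntermediateField.adjoin K {y} = ⊤) (hrank : Module.finrank K L = 3) :
    Algebra.discr K ![1, y, y ^ 2] = a ^ 3 := by
  have hsep := isSeparable_of_adjoin_eq_top h3 ha hy htop
  have : FiniteDimensional K L := Module.finite_of_finrank_eq_succ hrank
  have hint : IsIntegral K y := ⟨cubic a b, cubic_monic a b, hy⟩
  have hmin : minpoly K y = cubic a b := by
    refine (eq_of_monic_of_dvd_of_natDegree_le (minpoly.monic hint) (cubic_monic a b)
      (minpoly.dvd K y hy) ?_).symm
    rw [natDegree_cubic, ← IntermediateField.adjoin.finrank hint, htop,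
      IntermediateField.finrank_top', hrank]
  have htop' : Algebra.adjoin K {y} = ⊤ := by
    rw [← IntermediateField.adjoin_simple_toSubalgebra_of_isAlgebraic hint.isAlgebraic, htop,
      IntermediateField.top_toSubalgebra]
  let pb := PowerBasis.ofAdjoinEqTop hint htop'
  have hgen : pb.gen = y := PowerBasis.ofAdjoinEqTop_gen hint htop'
  have hdim : pb.dim = 3 := by rw [← pb.finrank, hrank]
  have hd := Algebra.discr_powerBasis_eq_norm K pb
  rw [hgen, hmin, derivative_cubic h3, aeval_C, Algebra.norm_algebraMap, hrank,
    ← Algebra.discr_reindex K pb.basis (finCongr hdim)] at hd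
  convert hd using 1
  · congr 1
    ext i
    fin_cases i <;> simp [hgen]
  · norm_num
    ring

/-- The discriminant of `1, z, z ^ 2` for a root `z` of the cubic is `A ^ 3`. -/
theorem discr_powers [IsDomain R] (K : Type*) [Field K] [Algebra R K] [IsFractionRing R K]
    {S : Type*} [CommRing S] [Algebra R S] (L : Type*) [Field L] [Algebra S L] [Algebra K L]
    [Algebra R L] [IsScalarTower R K L] [IsScalarTower R S L]
    [IsLocalization (Algebra.algebraMapSubmonoid S (nonZeroDivisors R)) L]
    (w : Module.Basis (Fin 3) R S)
    (h3 : (3 : R) = 0) {a b : R} (ha : a ≠ 0) {z : S}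
    (hz : z ^ 3 - algebraMap R S a * z + algebraMap R S b = 0)
    (htop : IntermediateField.adjoin K {algebraMap S L z} = ⊤) :
    Algebra.discr R ![1, z, z ^ 2] = a ^ 3 := by
  have := Module.Free.of_basis w
  have := Module.Finite.of_basis w
  have hrank : Module.finrank K L = 3 := by
    rw [Module.finrank_eq_card_basis (w.localizationLocalization K (nonZeroDivisors R) L),
      Fintype.card_fin]
  have h3K : (3 : K) = 0 := by rw [← map_ofNat (algebraMap R K) 3, h3, map_zero]
  have hroot : aeval (algebraMap S L z) (cubic (algebraMap R K a) (algebraMap R K b)) = 0 := by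
    have h := congrArg (algebraMap S L) hz
    rw [aeval_cubic]
    simpa only [map_add, map_sub, map_mul, map_pow, map_zero, ← IsScalarTower.algebraMap_apply]
      using h
  have h := discr_powers_field h3K ((map_ne_zero_iff _ (IsFractionRing.injective R K)).mpr ha)
    hroot htop hrank
  apply IsFractionRing.injective R K
  rw [map_pow, ← h, Algebra.discr_def, Algebra.discr_def, RingHom.map_det]
  congr 1
  ext i j
  rw [RingHom.mapMatrix_apply, Matrix.map_apply, Algebra.traceMatrix_apply,
    Algebra.traceMatrix_apply, Algebra.traceForm_apply, Algebra.traceForm_apply,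
    ← Algebra.trace_localization R (Sₘ := L) (nonZeroDivisors R), map_mul]
  fin_cases i <;> fin_cases j <;> simp

end Cubic

/-! ### Counting roots over a finite field -/

section FiniteField

variable {K : Type*} [Field K] [Fintype K]

/-- T^q - T is the product of all T - c, so the gcd is the product of those T - c that divide `f`.
-/
theorem natDegree_gcd_X_pow_card_sub_X [DecidableEq K] (f : K[X]) :
    (EuclideanDomain.gcd (X ^ Fintype.card K - X) f).natDegree =
      (Finset.univ.filter fun c => f.eval c = 0).card := by
  set g : K[X] := X ^ Fintype.card K - X with hg
  set d := EuclideanDomain.gcd g f with hd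
  have hg0 : g ≠ 0 := FiniteField.X_pow_card_sub_X_ne_zero K Fintype.one_lt_card
  have hdg : d ∣ g := EuclideanDomain.gcd_dvd_left _ _
  have hgs : g.Splits := by
    rw [splits_iff_card_roots, hg, FiniteField.roots_X_pow_card_sub_X,
      FiniteField.X_pow_card_sub_X_natDegree_eq K Fintype.one_lt_card]
    rfl
  have hd0 : d ≠ 0 := ne_zero_of_dvd_ne_zero hg0 hdg
  have hnodup : d.roots.Nodup := by
    refine Multiset.nodup_of_le (roots.le_of_dvd hg0 hdg) ?_
    rw [hg, FiniteField.roots_X_pow_card_sub_X]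
    exact Finset.univ.nodup
  rw [(hgs.of_dvd hg0 hdg).natDegree_eq_card_roots, ← Multiset.toFinset_card_of_nodup hnodup]
  congr 1
  ext c
  have hgc : g.eval c = 0 := by simp [hg, FiniteField.pow_card]
  rw [Multiset.mem_toFinset, mem_roots hd0, Finset.mem_filter, ← dvd_iff_isRoot]
  refine ⟨fun h => ⟨Finset.mem_univ c, ?_⟩, fun h => EuclideanDomain.dvd_gcd ?_ ?_⟩
  · exact dvd_iff_isRoot.mp (h.trans (EuclideanDomain.gcd_dvd_right _ _))
  · exact dvd_iff_isRoot.mpr hgc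
  · exact dvd_iff_isRoot.mpr h.2

/-- In characteristic three, two roots of the cubic `T ^ 3 - a * T + b` determine a third one. -/
theorem card_roots_cubic [DecidableEq K] (h3 : (3 : K) = 0) {a b : K} :
    (Finset.univ.filter fun c => (cubic a b).eval c = 0).card = 0 ∨
    (Finset.univ.filter fun c => (cubic a b).eval c = 0).card = 1 ∨
    (Finset.univ.filter fun c => (cubic a b).eval c = 0).card = 3 := by
  set Z := Finset.univ.filter fun c => (cubic a b).eval c = 0 with hZ
  have hmem : ∀ c, c ∈ Z ↔ c ^ 3 - a * c + b = 0 := fun c => by simp [hZ, eval_cubic]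
  have hle : Z.card ≤ 3 := by
    rw [← natDegree_cubic a b]
    refine card_le_degree_of_subset_roots fun c hc => ?_
    rw [mem_roots (cubic_monic a b).ne_zero]
    exact (Finset.mem_filter.mp hc).2
  by_contra! hno
  have h2 : Z.card = 2 := by lia
  obtain ⟨r, s, hrs, hrs'⟩ := Finset.card_eq_two.mp h2
  have hr := (hmem r).mp (by simp [hrs'])
  have hs := (hmem s).mp (by simp [hrs'])
  -- The T² coefficient is zero, so the roots sum to zero. In characteristic three -r - s equals `r`
  -- or `s` only if r = s.
  have ht : -r - s ∈ Z := by
    rw [hmem]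
    linear_combination -hr - hs + (b - r ^ 2 * s - r * s ^ 2) * h3
  rw [hrs', Finset.mem_insert, Finset.mem_singleton] at ht
  rcases ht with h | h
  · exact hrs (by linear_combination h + r * h3)
  · exact hrs (by linear_combination -h - s * h3)

end FiniteField

/-! ### The cubic over the residue field of the prime -/

section Residue

variable {k : Type*} [Field k] [Fintype k] (A B P : k[X]) [Fact (Irreducible P)]

theorem card_adjoinRoot [Fintype (AdjoinRoot P)] :
    Fintype.card (AdjoinRoot P) = Fintype.card k ^ P.natDegree := by
  have hP : P ≠ 0 := (Fact.out : Irreducible P).ne_zero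
  rw [Module.card_eq_pow_finrank (K := k), (AdjoinRoot.powerBasis hP).finrank,
    AdjoinRoot.powerBasis_dim]

theorem eval_mk_cubic (c : k[X]) :
    (cubic (AdjoinRoot.mk P A) (AdjoinRoot.mk P B)).eval (AdjoinRoot.mk P c) = 0 ↔
      P ∣ c ^ 3 - A * c + B := by
  rw [eval_cubic, ← AdjoinRoot.mk_eq_zero]
  simp only [map_add, map_sub, map_mul, map_pow]

/-- The degree of `splittingGcd` describes the roots of the cubic modulo `P`. -/
theorem natDegree_splittingGcd (h3 : (3 : k[X]) = 0) :
    ((splittingGcd A B P).natDegree = 0 ∧ ∀ c, ¬ P ∣ c ^ 3 - A * c + B) ∨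
    ((splittingGcd A B P).natDegree = 1 ∧ ∃ c, P ∣ c ^ 3 - A * c + B ∧
      ∀ d, P ∣ d ^ 3 - A * d + B → P ∣ d - c) ∨
    ((splittingGcd A B P).natDegree = 3 ∧ ∃ c δ, P ∣ c ^ 3 - A * c + B ∧ P ∣ δ ^ 2 - A) := by
  classical
  have hP : P ≠ 0 := (Fact.out : Irreducible P).ne_zero
  have : Module.Finite k (AdjoinRoot P) := (AdjoinRoot.powerBasis hP).finite
  have : Finite (AdjoinRoot P) := Module.finite_of_finite k
  let _ := Fintype.ofFinite (AdjoinRoot P)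
  have h3' : (3 : AdjoinRoot P) = 0 := by rw [← map_ofNat (AdjoinRoot.mk P) 3, h3, map_zero]
  have hdeg : (splittingGcd A B P).natDegree = (Finset.univ.filter fun c =>
      (cubic (AdjoinRoot.mk P A) (AdjoinRoot.mk P B)).eval c = 0).card := by
    rw [← natDegree_gcd_X_pow_card_sub_X, card_adjoinRoot, splittingGcd]
  have hcard := card_roots_cubic h3' (a := AdjoinRoot.mk P A) (b := AdjoinRoot.mk P B)
  set Z := Finset.univ.filter fun c =>
    (cubic (AdjoinRoot.mk P A) (AdjoinRoot.mk P B)).eval c = 0 with hZ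
  have hmem : ∀ c, AdjoinRoot.mk P c ∈ Z ↔ P ∣ c ^ 3 - A * c + B := fun c => by
    rw [hZ, Finset.mem_filter, eval_mk_cubic]
    simp
  rw [hdeg]
  rcases hcard with h | h | h
  · refine Or.inl ⟨h, fun c hc => ?_⟩
    rw [← hmem, Finset.card_eq_zero.mp h] at hc
    exact Finset.notMem_empty _ hc
  · obtain ⟨c, hc⟩ := Finset.card_eq_one.mp h
    obtain ⟨c, rfl⟩ := AdjoinRoot.mk_surjective c
    refine Or.inr (Or.inl ⟨h, c, ?_, fun d hd => ?_⟩)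
    · rw [← hmem, hc]
      exact Finset.mem_singleton_self _
    · rw [← hmem, hc, Finset.mem_singleton] at hd
      rwa [← AdjoinRoot.mk_eq_mk]
  · obtain ⟨r, hr, s, hs, hrs⟩ := Finset.one_lt_card.mp (by lia : 1 < Z.card)
    obtain ⟨r, rfl⟩ := AdjoinRoot.mk_surjective r
    obtain ⟨s, rfl⟩ := AdjoinRoot.mk_surjective s
    -- Subtracting the two root equations gives (r - s)((r - s)² - A) ≡ 0 modulo `P`.
    refine Or.inr (Or.inr ⟨h, r, r - s, (hmem r).mp hr, ?_⟩)
    have hP' : Prime P := (Fact.out : Irreducible P).prime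
    rw [Ne, AdjoinRoot.mk_eq_mk] at hrs
    refine (hP'.dvd_or_dvd (a := r - s) ?_).resolve_left hrs
    convert dvd_sub ((hmem r).mp hr) ((hmem s).mp hs) using 1
    linear_combination (r * s ^ 2 - r ^ 2 * s) * h3

/-- Over the perfect residue field, the cubic can be translated so that its constant term vanishes
modulo a prime dividing `A`. -/
theorem exists_dvd_eval (hA : P ∣ A) [CharP k 3] : ∃ i, P ∣ i ^ 3 - i * A + B := by
  have hP : P ≠ 0 := (Fact.out : Irreducible P).ne_zero
  have : Module.Finite k (AdjoinRoot P) := (AdjoinRoot.powerBasis hP).finite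
  have : Finite (AdjoinRoot P) := Module.finite_of_finite k
  have : CharP (AdjoinRoot P) 3 := charP_of_injective_algebraMap (algebraMap k _).injective 3
  have : Fact (Nat.Prime 3) := ⟨Nat.prime_three⟩
  -- Frobenius is onto, so i³ ≡ -B; the term i A vanishes modulo `P`.
  obtain ⟨i, hi⟩ := (Finite.injective_iff_surjective.mp
    (frobenius_inj (AdjoinRoot P) 3)) (AdjoinRoot.mk P (-B))
  obtain ⟨i, rfl⟩ := AdjoinRoot.mk_surjective i
  rw [frobenius_def, ← map_pow, AdjoinRoot.mk_eq_mk] at hi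
  refine ⟨i, ?_⟩
  convert dvd_sub hi (hA.mul_left i) using 1
  ring

end Residue

/-- The ramified primes of a standard model: the cubic has a unique Newton slope with denominator
three, or a segment of slope one half. -/
theorem ramified_cases {R S : Type*} [CommRing R] [IsDomain R] [IsPrincipalIdealRing R]
    [CommRing S] [IsDedekindDomain S] [Algebra R S] (w : Module.Basis (Fin 3) R S)
    {P : R} (hP : Prime P) (h3 : (3 : R) = 0) {A B : R} {z : S}
    (hz : z ^ 3 - algebraMap R S A * z + algebraMap R S B = 0)
    (hd : Algebra.discr R ![1, z, z ^ 2] = A ^ 3) (hA : P ∣ A) (hB : P ∣ B)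
    (hred : ¬ (P ^ 2 ∣ A ∧ P ^ 3 ∣ B)) :
    ((∃ 𝔭 : Ideal S, 𝔭.IsPrime ∧ Ideal.span {algebraMap R S P} = 𝔭 ^ 3) ∧
      2 < emultiplicity P (Algebra.discr R w)) ∨
    ((∃ 𝔭 𝔮 : Ideal S, 𝔭.IsPrime ∧ 𝔮.IsPrime ∧ 𝔭 ≠ 𝔮 ∧
      Ideal.span {algebraMap R S P} = 𝔮 * 𝔭 ^ 2) ∧
      emultiplicity P (Algebra.discr R w) = 1) := by
  have key : P ^ 3 ∣ Algebra.discr R w → 2 < emultiplicity P (Algebra.discr R w) := fun h =>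
    lt_of_lt_of_le (by norm_num) (pow_dvd_iff_le_emultiplicity.mp h)
  -- Slope 1/3 is v(B) = 1. Otherwise v(A) = 1 gives a segment of slope 1/2, and v(A) ≥ 2 forces
  -- v(B) = 2 by reducedness, hence slope 2/3.
  by_cases hB2 : P ^ 2 ∣ B
  · by_cases hA2 : P ^ 2 ∣ A
    · have h := span_eq_pow_three w hP h3 hz (m := 2) (by norm_num) hA2 hB2
        fun h => hred ⟨hA2, h⟩
      exact Or.inl ⟨h.1, key h.2⟩
    · exact Or.inr (span_eq_mul_sq w hP hz hd hA hA2 hB2)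
  · have h := span_eq_pow_three w hP h3 hz (m := 1) (by norm_num) (by rwa [pow_one])
      (by rwa [pow_one]) hB2
    exact Or.inl ⟨h.1, key h.2⟩

/-! ### Finiteness and separability of the function field -/

section FunctionField

variable {k : Type*} [Field k] {F : Type*} [Field F] [Algebra k[X] F] [Algebra (RatFunc k) F]
  [IsScalarTower k[X] (RatFunc k) F]

theorem finiteDimensional_and_isSeparable {A B : k[X]} (h3 : (3 : k[X]) = 0) (hA : A ≠ 0) {y : F}
    (hy : aeval y (cubic A B) = 0) (hF : IntermediateField.adjoin (RatFunc k) {y} = ⊤) :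
    FiniteDimensional (RatFunc k) F ∧ Algebra.IsSeparable (RatFunc k) F := by
  have h3K : (3 : RatFunc k) = 0 := by
    rw [← map_ofNat (algebraMap k[X] (RatFunc k)) 3, h3, map_zero]
  have hy' : aeval y (cubic (algebraMap k[X] (RatFunc k) A) (algebraMap k[X] (RatFunc k) B)) = 0 := by
    rwa [← map_cubic, aeval_map_algebraMap]
  have hint : IsIntegral (RatFunc k) y := ⟨_, cubic_monic _ _, hy'⟩
  refine ⟨?_, isSeparable_of_adjoin_eq_top h3K
    ((map_ne_zero_iff _ (IsFractionRing.injective k[X] (RatFunc k))).mpr hA) hy' hF⟩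
  have := IntermediateField.adjoin.finiteDimensional hint
  rw [hF] at this
  exact Module.Finite.equiv (IntermediateField.topEquiv (F := RatFunc k) (E := F)).toLinearEquiv

end FunctionField
end CubicCharThree

/-! ### The decomposition law -/

theorem theoremt {k : Type*} [Field k] [Fintype k] [CharP k 3]
    {F : Type*} [Field F] [Algebra k[X] F] [Algebra (RatFunc k) F]
    [IsScalarTower k[X] (RatFunc k) F]
    (A B : k[X]) (hAB : CubicCharThree.IsStandardModel A B)
    (y : F) (hy : aeval y (CubicCharThree.cubic A B) = 0)
    (hF : IntermediateField.adjoin (RatFunc k) {y} = ⊤)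
    (w : Module.Basis (Fin 3) k[X] (FunctionField.ringOfIntegers k F))
    (Δ : k[X]) (hΔ : Δ = Algebra.discr k[X] w)
    (P : k[X]) [Fact (Irreducible P)] :
    (2 < emultiplicity P Δ →
      ∃ 𝔭 : Ideal (FunctionField.ringOfIntegers k F), 𝔭.IsPrime ∧
        Ideal.span {algebraMap k[X] (FunctionField.ringOfIntegers k F) P} = 𝔭 ^ 3) ∧
    (emultiplicity P Δ = 1 →
      ∃ 𝔭 𝔮 : Ideal (FunctionField.ringOfIntegers k F), 𝔭.IsPrime ∧ 𝔮.IsPrime ∧ 𝔭 ≠ 𝔮 ∧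
        Ideal.span {algebraMap k[X] (FunctionField.ringOfIntegers k F) P} = 𝔮 * 𝔭 ^ 2) ∧
    (¬ 2 < emultiplicity P Δ → emultiplicity P Δ ≠ 1 →
      ¬ P ∣ A ∧
      ((CubicCharThree.splittingGcd A B P).natDegree = 0 ∨
        (CubicCharThree.splittingGcd A B P).natDegree = 1 ∨
        (CubicCharThree.splittingGcd A B P).natDegree = 3) ∧
      ((CubicCharThree.splittingGcd A B P).natDegree = 0 →
        ∃ 𝔭 : Ideal (FunctionField.ringOfIntegers k F), 𝔭.IsPrime ∧
          Ideal.span {algebraMap k[X] (FunctionField.ringOfIntegers k F) P} = 𝔭) ∧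
      ((CubicCharThree.splittingGcd A B P).natDegree = 1 →
        ∃ 𝔭 𝔮 : Ideal (FunctionField.ringOfIntegers k F), 𝔭.IsPrime ∧ 𝔮.IsPrime ∧ 𝔭 ≠ 𝔮 ∧
          Ideal.span {algebraMap k[X] (FunctionField.ringOfIntegers k F) P} = 𝔭 * 𝔮) ∧
      ((CubicCharThree.splittingGcd A B P).natDegree = 3 →
        ∃ 𝔭 𝔮 𝔯 : Ideal (FunctionField.ringOfIntegers k F),
          𝔭.IsPrime ∧ 𝔮.IsPrime ∧ 𝔯.IsPrime ∧ 𝔭 ≠ 𝔮 ∧ 𝔭 ≠ 𝔯 ∧ 𝔮 ≠ 𝔯 ∧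
          Ideal.span {algebraMap k[X] (FunctionField.ringOfIntegers k F) P} = 𝔭 * 𝔮 * 𝔯)) := by
  have hirr : Irreducible P := Fact.out
  have hP : Prime P := hirr.prime
  have h3 : (3 : k[X]) = 0 := by exact_mod_cast CharP.cast_eq_zero k[X] 3
  obtain ⟨hfin, hsep⟩ := CubicCharThree.finiteDimensional_and_isSeparable h3 hAB.ne_zero hy hF
  have : FunctionField k F := hfin
  have := IsIntegralClosure.isLocalization k[X] (RatFunc k) F (FunctionField.ringOfIntegers k F)
  subst hΔ
  let z : FunctionField.ringOfIntegers k F := ⟨y, CubicCharThree.cubic A B,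
    CubicCharThree.cubic_monic A B, hy⟩
  have hz : z ^ 3 - algebraMap k[X] _ A * z + algebraMap k[X] _ B = 0 := by
    rw [← CubicCharThree.aeval_cubic]
    apply FaithfulSMul.algebraMap_injective (FunctionField.ringOfIntegers k F) F
    rw [← aeval_algebraMap_apply, map_zero]
    exact hy
  have hd : Algebra.discr k[X] ![1, z, z ^ 2] = A ^ 3 :=
    CubicCharThree.discr_powers (RatFunc k) F w h3 hAB.ne_zero hz hF
  by_cases hA : P ∣ A
  · obtain ⟨i, hi⟩ := CubicCharThree.exists_dvd_eval A B P hA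
    have h3S : (3 : FunctionField.ringOfIntegers k F) = 0 := by
      rw [← map_ofNat (algebraMap k[X] _) 3, h3, map_zero]
    -- Cubing is additive, so z - i satisfies a cubic with the same `A`.
    have hz' : (z - algebraMap k[X] _ i) ^ 3 - algebraMap k[X] _ A * (z - algebraMap k[X] _ i) +
        algebraMap k[X] _ (i ^ 3 - i * A + B) = 0 := by
      simp only [map_add, map_sub, map_mul, map_pow]
      linear_combination hz + (z * algebraMap k[X] _ i ^ 2 - z ^ 2 * algebraMap k[X] _ i) * h3S
    have hd' := (CubicCharThree.discr_powers_sub z i).trans hd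
    rcases CubicCharThree.ramified_cases w hP h3 hz' hd' hA hi
      fun h => hirr.natDegree_pos.ne' (hAB.reduced P i h.1 h.2) with ⟨h, hv⟩ | ⟨h, hv⟩
    · exact ⟨fun _ => h, fun h1 => by simp [h1] at hv, fun h2 => absurd hv h2⟩
    · exact ⟨fun h2 => by simp [hv] at h2, fun _ => h, fun _ h1 => absurd hv h1⟩
  -- Here A³ = J² Δ, so `P ∤ A` gives `P ∤ Δ`.
  · have hv : emultiplicity P (Algebra.discr k[X] w) = 0 := by
      rw [emultiplicity_eq_zero]
      intro h
      obtain ⟨J, hJ⟩ := CubicCharThree.exists_discr_eq w ![1, z, z ^ 2]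
      exact hA (hP.dvd_of_dvd_pow (n := 3) (by rw [← hd, hJ]; exact h.mul_left _))
    refine ⟨fun h => by simp [hv] at h, fun h => by simp [hv] at h, fun _ _ => ⟨hA, ?_⟩⟩
    rcases CubicCharThree.natDegree_splittingGcd A B P h3 with
      ⟨hdeg, hno⟩ | ⟨hdeg, c, hc, huniq⟩ | ⟨hdeg, c, δ, hc, hδ⟩
    · exact ⟨by simp [hdeg], fun _ => ⟨_, CubicCharThree.isPrime_span w hP hz hno, rfl⟩,
        by simp [hdeg], by simp [hdeg]⟩
    · exact ⟨by simp [hdeg], by simp [hdeg],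
        fun _ => CubicCharThree.span_eq_mul w hP h3 hz hd hA hc huniq, by simp [hdeg]⟩
    · exact ⟨by simp [hdeg], by simp [hdeg], by simp [hdeg],
        fun _ => CubicCharThree.span_eq_mul_mul w hP h3 hz hd hA hc hδ⟩
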